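/- Let $\mathbb D=\{z\in\mathbb C:|z|<1\}$. For a positive function $w$ on $[0,1)$, regarded as a radial function $w(z)=w(|z|)$ on $\mathbb D$, let $H_w(\mathbb D)$ be the space of all holomorphic functions $f$ on $\mathbb D$ with $\|f\|_w:=\sup_{z\in\mathbb D}|f(z)|/w(|z|)<\infty$, normed by $\|\cdot\|_w$. A radial weight on $\mathbb D$ is a positive continuous increasing function $v$ on $[0,1)$ with $\lim_{r\to1^-}v(r)=\infty$ ("increasing" means non-decreasing throughout). We call $w:[0,1)\to(0,\infty)$ a BBT-weight if $$w(r)=w(0)\exp\int_0^r\frac{\tau(\rho)}{1-\rho}\,d\rho,\qquad 0\le r<1,$$ for some positive increasing function $\tau$ on $[0,1)$ such that, for some $c>1$, $\tau\bigl(1-(1-\rho)/c\bigr)-\tau(\rho)\ge1$ for all $\rho\in[0,1)$. We call $w:[0,1)\to(0,\infty)$ an H-weight if $w$ is increasing, $x\mapsto\log w(e^x)$ is convex on $(-\infty,0)$, and $\log w$ is either of moderate growth, i.e. $\sup_{n\ge0}w(1-2^{-n-1})/w(1-2^{-n})<\infty$, or rapidly growing, i.e. $\log w$ is not of moderate growth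 and, for every $n\ge1$, $\log w(r)$ is an affine function of $\log r$ on $[r_n,r_{n+1}]$, where $r_n=\exp(-2^{-n})$. Let $w$ be a BBT-weight or an H-weight on $\mathbb D$ and let $v$ be an arbitrary radial weight on $\mathbb D$. Then the integration operator $(If)(z)=\int_0^z f(\zeta)\,d\zeta$ is a well-defined continuous linear operator $I:H_w(\mathbb D)\to H_v(\mathbb D)$ if and only if $$\limsup_{r\to1^-}\frac1{v(r)}\int_0^r w(t)\,dt<\infty.$$ -/

import Mathlib

open Set Filter Topology

noncomputable section

namespace DiscWeighted

/-- The open unit disc of the complex plane. -/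
abbrev Disc : Set ℂ := Metric.ball (0 : ℂ) 1

/-- A positive radial function on the unit disc, `z ↦ w |z|`, given by its profile on `[0, 1)`.
Values of the profile outside `[0, 1)` are irrelevant. -/
structure RadialFun where
  toFun : ℝ → ℝ
  pos : ∀ r ∈ Ico (0 : ℝ) 1, 0 < toFun r

instance : CoeFun RadialFun (fun _ => ℝ → ℝ) := ⟨RadialFun.toFun⟩

/-- Radial weights on the disc: continuous, increasing on `[0, 1)`, tending to infinity at `1`. -/
structure RadialFun.IsRadialWeight (v : RadialFun) : Prop where
  continuousOn : ContinuousOn v (Ico 0 1)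
  monotoneOn : MonotoneOn v (Ico 0 1)
  tendsto : Tendsto v (𝓝[<] 1) atTop

/-- `w` is log-convex: `x ↦ log w(e^x)` is convex on `(-∞, 0)`. -/
def RadialFun.IsLogConvex (w : RadialFun) : Prop :=
  ConvexOn ℝ (Iio (0 : ℝ)) (fun x => Real.log (w (Real.exp x)))

/-- BBT-weights: `w(r) = w(0) exp ∫₀^r τ(ρ)/(1-ρ) dρ` with `τ` positive and increasing on `[0, 1)`
and `τ(1-(1-ρ)/c) - τ(ρ) ≥ 1` for some `c > 1`. -/
def RadialFun.IsBBT (w : RadialFun) : Prop :=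
  ∃ τ : ℝ → ℝ, (∀ ρ ∈ Ico (0 : ℝ) 1, 0 < τ ρ) ∧ MonotoneOn τ (Ico 0 1) ∧
    (∃ c : ℝ, 1 < c ∧ ∀ ρ ∈ Ico (0 : ℝ) 1, 1 ≤ τ (1 - (1 - ρ) / c) - τ ρ) ∧
    ∀ r ∈ Ico (0 : ℝ) 1, w r = w 0 * Real.exp (∫ ρ in (0 : ℝ)..r, τ ρ / (1 - ρ))

/-- `log w` is of moderate growth: `sup_n w(1-2^{-n-1}) / w(1-2^{-n}) < ∞`. -/
def RadialFun.ModerateGrowth (w : RadialFun) : Prop :=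
  BddAbove (range fun n : ℕ => w (1 - (1 / 2 : ℝ) ^ (n + 1)) / w (1 - (1 / 2 : ℝ) ^ n))

/-- `log w` is rapidly growing: it is not of moderate growth, and it is an affine function of
`log r` between consecutive points `r_n = exp(-2^{-n})`, `n ≥ 1`. -/
def RadialFun.RapidlyGrowing (w : RadialFun) : Prop :=
  ¬ w.ModerateGrowth ∧
    ∀ n : ℕ, 1 ≤ n → ∃ a b : ℝ,
      ∀ r ∈ Icc (Real.exp (-(1 / 2 : ℝ) ^ n)) (Real.exp (-(1 / 2 : ℝ) ^ (n + 1))),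
        Real.log (w r) = a * Real.log r + b

/-- H-weights: increasing log-convex functions on `[0, 1)` whose logarithm is of moderate growth
or rapidly growing. -/
structure RadialFun.IsHWeight (w : RadialFun) : Prop where
  monotoneOn : MonotoneOn w (Ico 0 1)
  logConvex : w.IsLogConvex
  growth : w.ModerateGrowth ∨ w.RapidlyGrowing

/-- Extension by zero of a function on the disc to the plane. -/
def ext (f : Disc → ℂ) : ℂ → ℂ := Function.extend Subtype.val f 0

theorem ext_apply (f : Disc → ℂ) (z : Disc) : ext f z = f z :=
  Subtype.val_injective.extend_apply f 0 z

/-- `f` is holomorphic on the disc. -/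
def IsHol (f : Disc → ℂ) : Prop := DifferentiableOn ℂ (ext f) Disc

theorem isHol_of_eqOn {f : Disc → ℂ} {F : ℂ → ℂ} (hF : DifferentiableOn ℂ F Disc)
    (h : ∀ z : Disc, f z = F z) : IsHol f :=
  hF.congr fun z hz => by rw [← h ⟨z, hz⟩]; exact ext_apply f ⟨z, hz⟩

theorem RadialFun.pos_norm (w : RadialFun) (z : Disc) : 0 < w ‖(z : ℂ)‖ :=
  w.pos _ ⟨norm_nonneg _, mem_ball_zero_iff.1 z.2⟩

/-- The space `H_w` of holomorphic functions `f` on the disc with `sup |f| / w < ∞`,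
as a linear subspace of all functions on the disc. -/
def HSub (w : RadialFun) : Submodule ℂ (Disc → ℂ) where
  carrier := {f | IsHol f ∧ BddAbove (range fun z : Disc => ‖f z‖ / w ‖(z : ℂ)‖)}
  zero_mem' := ⟨isHol_of_eqOn (F := 0) (differentiableOn_const 0) (fun _ => rfl),
    ⟨0, by rintro _ ⟨z, rfl⟩; simp⟩⟩
  add_mem' := by
    rintro f g ⟨hf, A, hA⟩ ⟨hg, B, hB⟩
    refine ⟨isHol_of_eqOn (hf.add hg) fun z => by simp [ext_apply], A + B, ?_⟩
    rintro _ ⟨z, rfl⟩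
    calc ‖f z + g z‖ / w ‖(z : ℂ)‖ ≤ (‖f z‖ + ‖g z‖) / w ‖(z : ℂ)‖ :=
          div_le_div_of_nonneg_right (norm_add_le _ _) (w.pos_norm z).le
      _ = ‖f z‖ / w ‖(z : ℂ)‖ + ‖g z‖ / w ‖(z : ℂ)‖ := add_div _ _ _
      _ ≤ A + B := add_le_add (hA ⟨z, rfl⟩) (hB ⟨z, rfl⟩)
  smul_mem' := by
    rintro c f ⟨hf, A, hA⟩
    refine ⟨isHol_of_eqOn (hf.const_smul c) fun z => by simp [ext_apply], ‖c‖ * A, ?_⟩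
    rintro _ ⟨z, rfl⟩
    have : ‖(c • f) z‖ / w ‖(z : ℂ)‖ = ‖c‖ * (‖f z‖ / w ‖(z : ℂ)‖) := by
      simp [mul_div_assoc]
    simp only [this]
    exact mul_le_mul_of_nonneg_left (hA ⟨z, rfl⟩) (norm_nonneg c)

/-- The normed space `H_w(𝔻)`. -/
def HSpace (w : RadialFun) : Type := HSub w

instance (w : RadialFun) : AddCommGroup (HSpace w) := inferInstanceAs (AddCommGroup (HSub w))
instance (w : RadialFun) : Module ℂ (HSpace w) := inferInstanceAs (Module ℂ (HSub w))
instance (w : RadialFun) : CoeFun (HSpace w) (fun _ => Disc → ℂ) := ⟨fun f => f.1⟩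

/-- The norm `‖f‖_w = sup_{z ∈ 𝔻} |f z| / w |z|`. -/
instance (w : RadialFun) : Norm (HSpace w) := ⟨fun f => ⨆ z : Disc, ‖f z‖ / w ‖(z : ℂ)‖⟩

theorem HSpace.norm_def {w : RadialFun} (f : HSpace w) :
    ‖f‖ = ⨆ z : Disc, ‖f z‖ / w ‖(z : ℂ)‖ := rfl

theorem HSpace.le_norm {w : RadialFun} (f : HSpace w) (z : Disc) :
    ‖f z‖ / w ‖(z : ℂ)‖ ≤ ‖f‖ := le_ciSup f.2.2 z

instance : Nonempty Disc := ⟨⟨0, by simp⟩⟩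

theorem HSpace.norm_core (w : RadialFun) : NormedSpace.Core ℂ (HSpace w) where
  norm_nonneg f := Real.iSup_nonneg fun z => div_nonneg (norm_nonneg _) (w.pos_norm z).le
  norm_smul c f := by
    rw [HSpace.norm_def, HSpace.norm_def, Real.mul_iSup_of_nonneg (norm_nonneg c)]
    refine iSup_congr fun z => ?_
    rw [← mul_div_assoc, ← norm_mul]
    rfl
  norm_triangle f g := by
    refine ciSup_le fun z => ?_
    calc ‖f z + g z‖ / w ‖(z : ℂ)‖ ≤ (‖f z‖ + ‖g z‖) / w ‖(z : ℂ)‖ :=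
          div_le_div_of_nonneg_right (norm_add_le _ _) (w.pos_norm z).le
      _ = ‖f z‖ / w ‖(z : ℂ)‖ + ‖g z‖ / w ‖(z : ℂ)‖ := add_div _ _ _
      _ ≤ ‖f‖ + ‖g‖ := add_le_add (f.le_norm z) (g.le_norm z)
  norm_eq_zero_iff f := by
    constructor
    · intro h
      refine Subtype.ext (funext fun z => ?_)
      have h1 : ‖f z‖ / w ‖(z : ℂ)‖ ≤ 0 := h ▸ f.le_norm z
      have h2 : ‖f z‖ ≤ 0 := by
        have := (div_le_iff₀ (w.pos_norm z)).1 h1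
        simpa using this
      exact norm_le_zero_iff.1 h2
    · rintro rfl
      have : ∀ z : Disc, ‖(0 : HSpace w) z‖ / w ‖(z : ℂ)‖ = 0 := fun z => by
        rw [show (0 : HSpace w) z = 0 from rfl]; simp
      rw [HSpace.norm_def]
      simp only [this, ciSup_const]

instance (w : RadialFun) : NormedAddCommGroup (HSpace w) :=
  NormedAddCommGroup.ofCore (HSpace.norm_core w)

instance (w : RadialFun) : NormedSpace ℂ (HSpace w) := NormedSpace.ofCore (HSpace.norm_core w)

/-- The integration operator `(I f)(z) = ∫₀^z f(ζ) dζ`, the integral being taken along the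
segment from `0` to `z`. -/
def integration (f : Disc → ℂ) : Disc → ℂ :=
  fun z => (z : ℂ) * ∫ t in (0 : ℝ)..1, ext f ((t : ℂ) * z)

/-- The integration operator is a (well-defined) continuous linear operator from `H_w` to `H_v`. -/
def IntegrationBounded (w v : RadialFun) : Prop :=
  ∃ T : HSpace w →L[ℂ] HSpace v, ∀ f : HSpace w, (T f : Disc → ℂ) = integration f

end DiscWeighted

end

/-! Both kinds of weight are increasing and have a supporting line at every point when `log w` is
viewed as a function of `log r`; these two properties drive the proof. If the integrals of `w` are
dominated by `v`, integrating `|f| ≤ ‖f‖ w` along a radius bounds `I` (`norm_integration_le`).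
Conversely, `I` is tested at `R` on a polynomial `P` with non-negative coefficients, for which `P ≤
8 w` and `r w(r) ≤ e P(r)` on `(0, R]` (`RadialFun.HasLogSupport.exists_polynomial`). The norm of
`P` in `H_w` is bounded independently of `R`, so `∫₀^R P ≤ const · v(R)`, and this controls `∫ w`
away from `0`. To build `P`, supporting slopes are rounded up to integers, so that the lines `c_n +
n log r` below `log w` nearly attain it. Summing all the monomials `exp(c_n) r^n` could far exceed
`w`. Since `c_n` is concave in `n`, a minimal subfamily with maximum within `1` of the full one has
terms decaying geometrically away from the peak, so its sum is comparable to its largest term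
(`ConcaveSeq.exists_sparse`). -/

namespace DiscWeighted

/-! ### Selecting a sparse family of lines -/

/-- If `g` drops by the factor `1/2` whenever two steps are taken in `S`, then the sum of `g` over
`S` is at most four times any bound for `g`. -/
theorem sum_le_of_two_step_decay {ι : Type*} [LinearOrder ι] (g : ι → ℝ) (n : ℕ) :
    ∀ (S : Finset ι) (B : ℝ), S.card ≤ n → 0 ≤ B → (∀ s ∈ S, g s ≤ B) →
      (∀ p ∈ S, ∀ s ∈ S, ∀ q ∈ S, p < s → s < q → g q ≤ g p / 2) → ∑ s ∈ S, g s ≤ 4 * B := by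
  induction n using Nat.strong_induction_on with
  | _ n ih =>
    intro S B hn hB hg hdec
    rcases S.eq_empty_or_nonempty with rfl | hS
    · simpa using hB
    set p := S.min' hS with hp
    have hpS : p ∈ S := S.min'_mem hS
    rw [← Finset.add_sum_erase S g hpS]
    have hgp := hg p hpS
    rcases (S.erase p).eq_empty_or_nonempty with h0 | hS'
    · rw [h0, Finset.sum_empty]; linarith
    set s := (S.erase p).min' hS' with hs
    have hsS' : s ∈ S.erase p := (S.erase p).min'_mem hS'
    have hsS : s ∈ S := Finset.mem_of_mem_erase hsS'
    have hps : p < s := lt_of_le_of_ne (S.min'_le s hsS) (Finset.ne_of_mem_erase hsS').symm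
    rw [← Finset.add_sum_erase _ g hsS']
    have hgs := hg s hsS
    have hc1 : (S.erase p).card < S.card := Finset.card_erase_lt_of_mem hpS
    have hc2 : ((S.erase p).erase s).card < (S.erase p).card := Finset.card_erase_lt_of_mem hsS'
    -- Every element beyond `s` is two steps after `p`, so `B / 2` bounds the rest; the total is `B
    -- + B + 4 (B / 2) = 4 B`.
    have key : ∑ x ∈ (S.erase p).erase s, g x ≤ 4 * (B / 2) := by
      refine ih ((S.erase p).erase s).card (by omega) _ _ le_rfl (by linarith) ?_ ?_
      · intro q hq
        have hq1 := Finset.mem_of_mem_erase hq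
        have hsq : s < q := lt_of_le_of_ne ((S.erase p).min'_le q hq1)
          (Finset.ne_of_mem_erase hq).symm
        have := hdec p hpS s hsS q (Finset.mem_of_mem_erase hq1) hps hsq
        linarith
      · intro a ha b hb c hc
        exact hdec a (Finset.mem_of_mem_erase (Finset.mem_of_mem_erase ha))
          b (Finset.mem_of_mem_erase (Finset.mem_of_mem_erase hb))
          c (Finset.mem_of_mem_erase (Finset.mem_of_mem_erase hc))
    linarith

/-- Concavity of a sequence, in division-free form. -/
def ConcaveSeq (c : ℕ → ℝ) : Prop :=
  ∀ p n q : ℕ, p ≤ n → n ≤ q →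
    ((q : ℝ) - n) * c p + ((n : ℝ) - p) * c q ≤ ((q : ℝ) - p) * c n

theorem ConcaveSeq.add_linear {c : ℕ → ℝ} (hc : ConcaveSeq c) (x : ℝ) :
    ConcaveSeq fun n => c n + n * x := by
  intro p n q hpn hnq
  have := hc p n q hpn hnq
  nlinarith

/-- Applied to every tilt `c n + n x`, this quasi-concavity is the form in which concavity serves
the selection below. -/
theorem ConcaveSeq.min_le {c : ℕ → ℝ} (hc : ConcaveSeq c) {p n q : ℕ} (hpn : p ≤ n) (hnq : n ≤ q) :
    min (c p) (c q) ≤ c n := by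
  rcases hpn.eq_or_lt with rfl | h
  · exact min_le_left _ _
  have h1 := hc p n q hpn hnq
  have hp : (p : ℝ) < n := by exact_mod_cast h
  have hq : (n : ℝ) ≤ q := by exact_mod_cast hnq
  have h2 := mul_le_mul_of_nonneg_left (min_le_left (c p) (c q)) (sub_nonneg.2 hq)
  have h3 := mul_le_mul_of_nonneg_left (min_le_right (c p) (c q)) (sub_nonneg.2 hp.le)
  have h4 : ((q : ℝ) - p) * min (c p) (c q) ≤ ((q : ℝ) - p) * c n := by linarith
  exact le_of_mul_le_mul_left h4 (by linarith)

/-- From finitely many lines `x ↦ c n + n x` with concave `c` one can choose a subfamily whose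
maximum is everywhere within `1` of the full maximum and whose exponentials have a sum comparable
to the exponential of the maximum. -/
theorem ConcaveSeq.exists_sparse {c : ℕ → ℝ} (hc : ConcaveSeq c) (N : ℕ) :
    ∃ S : Finset ℕ, (∀ x : ℝ, ∀ n ≤ N, ∃ s ∈ S, c n + n * x ≤ c s + s * x + 1) ∧
      ∀ x : ℝ, ∃ n, ∑ s ∈ S, Real.exp (c s + s * x) ≤ 8 * Real.exp (c n + n * x) := by
  let good : Finset ℕ → Prop := fun S =>
    S ⊆ Finset.range (N + 1) ∧ ∀ x : ℝ, ∀ n ≤ N, ∃ s ∈ S, c n + n * x ≤ c s + s * x + 1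
  have hgood : ∃ S, good S := ⟨Finset.range (N + 1), subset_rfl, fun x n hn =>
    ⟨n, Finset.mem_range.2 (by omega), by linarith⟩⟩
  obtain ⟨S, ⟨hSN, hcov⟩, hmin⟩ := exists_minimal_of_wellFoundedLT good hgood
  refine ⟨S, hcov, fun x => ?_⟩
  -- By minimality, deleting `s` uncovers some line `n` at some `y`. There `s` is within `1` of `n`
  -- while `p` and `q` are not, so unimodality places `n` between them. Averaging the inequalities
  -- for `p` and `q` eliminates `y`.
  have hgap : ∀ p ∈ S, ∀ s ∈ S, ∀ q ∈ S, p < s → s < q → ∃ n, p < n ∧ n < q ∧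
      ((q : ℝ) - n) * c p + ((n : ℝ) - p) * c q + (q - p) < ((q : ℝ) - p) * c n := by
    intro p hp s hs q hq hps hsq
    have hnot : ¬ good (S.erase s) := fun h => by
      have := hmin h (Finset.erase_subset s S) hs
      simp at this
    have : ∃ y : ℝ, ∃ n ≤ N, ∀ t ∈ S.erase s, c t + t * y + 1 < c n + n * y := by
      by_contra! hcon
      exact hnot ⟨(Finset.erase_subset s S).trans hSN, hcon⟩
    obtain ⟨y, n, hnN, hn⟩ := this
    have hTp := hn p (Finset.mem_erase.2 ⟨hps.ne, hp⟩)
    have hTq := hn q (Finset.mem_erase.2 ⟨hsq.ne', hq⟩)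
    have hTs : c n + n * y ≤ c s + s * y + 1 := by
      obtain ⟨t, ht, h⟩ := hcov y n hnN
      by_cases hts : t = s
      · rwa [hts] at h
      · linarith [hn t (Finset.mem_erase.2 ⟨hts, ht⟩)]
    have hpn : p < n := by
      by_contra! h
      have := (hc.add_linear y).min_le h hps.le
      rcases min_le_iff.1 this with h' | h' <;> linarith
    have hnq : n < q := by
      by_contra! h
      have := (hc.add_linear y).min_le hsq.le h
      rcases min_le_iff.1 this with h' | h' <;> linarith
    refine ⟨n, hpn, hnq, ?_⟩
    have h1 : (0 : ℝ) < n - p := sub_pos.2 (by exact_mod_cast hpn)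
    have h2 : (0 : ℝ) < q - n := sub_pos.2 (by exact_mod_cast hnq)
    have h3 := mul_lt_mul_of_pos_left hTp h2
    have h4 := mul_lt_mul_of_pos_left hTq h1
    linarith
  have hT := hc.add_linear x
  obtain ⟨J, -, hJ⟩ := Finset.exists_max_image (Finset.range (N + 1)) (fun n => c n + n * x)
    ⟨0, by simp⟩
  -- At every `x` the chord from `p` to `q` passes more than `1` below the value at `n`. On one side
  -- of the peak `J` that value is at most the endpoint nearer `J`, so the farther endpoint lies at
  -- least `1` lower.
  have hstep : ∀ p ∈ S, ∀ s ∈ S, ∀ q ∈ S, p < s → s < q →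
      (J ≤ p → c q + q * x + 1 ≤ c p + p * x) ∧ (q ≤ J → c p + p * x + 1 ≤ c q + q * x) := by
    intro p hp s hs q hq hps hsq
    obtain ⟨n, hpn, hnq, h⟩ := hgap p hp s hs q hq hps hsq
    have hnN : n ∈ Finset.range (N + 1) := Finset.mem_range.2
      (hnq.trans (Finset.mem_range.1 (hSN hq)))
    have h1 : (0 : ℝ) < n - p := sub_pos.2 (by exact_mod_cast hpn)
    have h2 : (0 : ℝ) < q - n := sub_pos.2 (by exact_mod_cast hnq)
    have hJn := hJ n hnN
    constructor
    · intro hJp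
      have h3 : c n + n * x ≤ c p + p * x := (le_min hJn le_rfl).trans (hT.min_le hJp hpn.le)
      by_contra! hcon
      nlinarith [mul_lt_mul_of_pos_left hcon h1,
        mul_le_mul_of_nonneg_left h3 (add_pos h1 h2).le]
    · intro hqJ
      have h3 : c n + n * x ≤ c q + q * x := (le_min le_rfl hJn).trans (hT.min_le hnq.le hqJ)
      by_contra! hcon
      nlinarith [mul_lt_mul_of_pos_left hcon h2,
        mul_le_mul_of_nonneg_left h3 (add_pos h1 h2).le]
  have hexp : ∀ a b : ℝ, a + 1 ≤ b → Real.exp a ≤ Real.exp b / 2 := by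
    intro a b hab
    have h1 : Real.exp a * Real.exp 1 ≤ Real.exp b := by
      rw [← Real.exp_add]; exact Real.exp_le_exp.2 hab
    have h2 : (2 : ℝ) ≤ Real.exp 1 := by linarith [Real.add_one_le_exp (1 : ℝ)]
    nlinarith [Real.exp_pos a]
  refine ⟨J, ?_⟩
  set g : ℕ → ℝ := fun s => Real.exp (c s + s * x) with hg
  have hB : ∀ s ∈ S, g s ≤ g J := fun s hs => Real.exp_le_exp.2 (hJ s (hSN hs))
  have hright : ∑ s ∈ S with J ≤ s, g s ≤ 4 * g J := by
    refine sum_le_of_two_step_decay g _ _ _ le_rfl (Real.exp_pos _).le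
      (fun s hs => hB s (Finset.mem_filter.1 hs).1) ?_
    intro p hp s hs q hq hps hsq
    rw [Finset.mem_filter] at hp hs hq
    exact hexp _ _ ((hstep p hp.1 s hs.1 q hq.1 hps hsq).1 hp.2)
  -- To the left of `J` the decay runs towards smaller indices, hence the reversed order.
  have hleft : ∑ s ∈ S with ¬ J ≤ s, g s ≤ 4 * g J := by
    have h := sum_le_of_two_step_decay (fun s : ℕᵒᵈ => g (OrderDual.ofDual s)) _
      ({s ∈ S | ¬ J ≤ s}.map OrderDual.toDual.toEmbedding) (g J) le_rfl (Real.exp_pos _).le ?_ ?_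
    · simpa using h
    · intro s hs
      rw [Finset.mem_map_equiv, Finset.mem_filter] at hs
      exact hB _ hs.1
    · intro q hq s hs p hp hqs hsp
      rw [Finset.mem_map_equiv, Finset.mem_filter] at hp hs hq
      exact hexp _ _ ((hstep _ hp.1 _ hs.1 _ hq.1 hsp hqs).2 (not_le.1 hq.2).le)
  rw [← Finset.sum_filter_add_sum_filter_not S (fun s => J ≤ s)]
  linarith

/-! ### Log-convex weights and their minorants by monomials -/

/-- As a function of `log r`, `log w` has a supporting line at every point of `(0, 1)`. -/
def RadialFun.HasLogSupport (w : RadialFun) : Prop :=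
  ∀ r ∈ Ioo (0 : ℝ) 1, ∃ m : ℝ, ∀ s ∈ Ioo (0 : ℝ) 1,
    Real.log (w r) + m * (Real.log s - Real.log r) ≤ Real.log (w s)

theorem RadialFun.IsLogConvex.hasLogSupport {w : RadialFun} (hw : w.IsLogConvex) :
    w.HasLogSupport := by
  intro r hr
  set φ : ℝ → ℝ := fun x => Real.log (w (Real.exp x)) with hφ
  have hφlog : ∀ s ∈ Ioo (0 : ℝ) 1, φ (Real.log s) = Real.log (w s) := fun s hs => by
    simp only [hφ, Real.exp_log hs.1]
  have hlog : ∀ s ∈ Ioo (0 : ℝ) 1, Real.log s ∈ Iio (0 : ℝ) := fun s hs =>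
    Real.log_neg hs.1 hs.2
  have hint : Real.log r ∈ interior (Iio (0 : ℝ)) := by rw [interior_Iio]; exact hlog r hr
  refine ⟨derivWithin φ (Ioi (Real.log r)) (Real.log r), fun s hs => ?_⟩
  rw [← hφlog s hs, ← hφlog r hr]
  rcases lt_trichotomy (Real.log r) (Real.log s) with h | h | h
  · have := hw.rightDeriv_le_slope_of_mem_interior hint (hlog s hs) h
    rw [slope_def_field, le_div_iff₀ (sub_pos.2 h)] at this
    linarith
  · rw [h]; simp
  · have := (hw.slope_le_leftDeriv_of_mem_interior (hlog s hs) hint h).trans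
      (hw.leftDeriv_le_rightDeriv_of_mem_interior hint)
    rw [slope_def_field, div_le_iff₀ (sub_pos.2 h)] at this
    linarith

/-! ### Monotonicity and supporting lines of BBT-weights -/

theorem monotoneOn_div_one_sub {τ : ℝ → ℝ} (hpos : ∀ ρ ∈ Ico (0 : ℝ) 1, 0 < τ ρ)
    (hmono : MonotoneOn τ (Ico 0 1)) : MonotoneOn (fun ρ => τ ρ / (1 - ρ)) (Ico 0 1) := by
  intro a ha b hb hab
  exact div_le_div₀ (hpos b hb).le (hmono ha hb hab) (sub_pos.2 hb.2) (by linarith)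

theorem uIcc_subset_Ico {a b : ℝ} (ha : a ∈ Ico (0 : ℝ) 1) (hb : b ∈ Ico (0 : ℝ) 1) :
    uIcc a b ⊆ Ico (0 : ℝ) 1 := ordConnected_Ico.uIcc_subset ha hb

theorem intervalIntegrable_of_monotoneOn_Ico {u : ℝ → ℝ} (hu : MonotoneOn u (Ico 0 1)) {a b : ℝ}
    (ha : a ∈ Ico (0 : ℝ) 1) (hb : b ∈ Ico (0 : ℝ) 1) :
    IntervalIntegrable u MeasureTheory.volume a b :=
  (hu.mono (uIcc_subset_Ico ha hb)).intervalIntegrable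

theorem zero_mem_Ico_zero_one : (0 : ℝ) ∈ Ico (0 : ℝ) 1 := by simp

theorem RadialFun.IsBBT.log_sub_log {w : RadialFun} {τ : ℝ → ℝ}
    (hpos : ∀ ρ ∈ Ico (0 : ℝ) 1, 0 < τ ρ) (hmono : MonotoneOn τ (Ico 0 1))
    (hw : ∀ r ∈ Ico (0 : ℝ) 1, w r = w 0 * Real.exp (∫ ρ in (0 : ℝ)..r, τ ρ / (1 - ρ)))
    {r s : ℝ} (hr : r ∈ Ico (0 : ℝ) 1) (hs : s ∈ Ico (0 : ℝ) 1) :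
    Real.log (w s) - Real.log (w r) = ∫ ρ in r..s, τ ρ / (1 - ρ) := by
  have h0 := (w.pos 0 zero_mem_Ico_zero_one).ne'
  have hI := fun {a b : ℝ} (ha : a ∈ Ico (0 : ℝ) 1) (hb : b ∈ Ico (0 : ℝ) 1) =>
    intervalIntegrable_of_monotoneOn_Ico (monotoneOn_div_one_sub hpos hmono) ha hb
  rw [hw s hs, hw r hr, Real.log_mul h0 (Real.exp_ne_zero _), Real.log_mul h0 (Real.exp_ne_zero _),
    Real.log_exp, Real.log_exp, ← intervalIntegral.integral_interval_sub_left
      (hI zero_mem_Ico_zero_one hs) (hI zero_mem_Ico_zero_one hr)]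
  ring

theorem RadialFun.IsBBT.monotoneOn {w : RadialFun} (hw : w.IsBBT) : MonotoneOn w (Ico 0 1) := by
  obtain ⟨τ, hpos, hmono, -, hw⟩ := hw
  intro r hr s hs hrs
  rw [← Real.log_le_log_iff (w.pos r hr) (w.pos s hs), ← sub_nonneg,
    RadialFun.IsBBT.log_sub_log hpos hmono hw hr hs]
  refine intervalIntegral.integral_nonneg hrs fun ρ hρ => ?_
  have hρ' : ρ ∈ Ico (0 : ℝ) 1 := ⟨hr.1.trans hρ.1, hρ.2.trans_lt hs.2⟩
  exact div_nonneg (hpos ρ hρ').le (sub_pos.2 hρ'.2).le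

/-- The density of `log w` with respect to `d log ρ` is `ρ τ(ρ) / (1 - ρ)`, which is increasing; its
value at `r` serves as the slope. -/
theorem RadialFun.IsBBT.hasLogSupport {w : RadialFun} (hw : w.IsBBT) : w.HasLogSupport := by
  obtain ⟨τ, hpos, hmono, -, hw⟩ := hw
  have hg := monotoneOn_div_one_sub hpos hmono
  have hg0 : ∀ ρ ∈ Ico (0 : ℝ) 1, 0 ≤ τ ρ / (1 - ρ) := fun ρ hρ =>
    div_nonneg (hpos ρ hρ).le (sub_pos.2 hρ.2).le
  set g : ℝ → ℝ := fun ρ => τ ρ / (1 - ρ)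
  have hint : ∀ {a b : ℝ}, a ∈ Ioo (0 : ℝ) 1 → b ∈ Ioo (0 : ℝ) 1 → ∀ m : ℝ,
      IntervalIntegrable (fun ρ : ℝ => m * ρ⁻¹) MeasureTheory.volume a b := by
    intro a b ha hb m
    refine (ContinuousOn.intervalIntegrable ?_)
    refine continuousOn_const.mul (continuousOn_inv₀.mono fun x hx => ?_)
    exact (lt_of_lt_of_le (lt_min ha.1 hb.1) hx.1).ne'
  have hval : ∀ {a b : ℝ}, a ∈ Ioo (0 : ℝ) 1 → b ∈ Ioo (0 : ℝ) 1 → ∀ m : ℝ,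
      ∫ ρ in a..b, m * ρ⁻¹ = m * (Real.log b - Real.log a) := by
    intro a b ha hb m
    rw [intervalIntegral.integral_const_mul, integral_inv_of_pos ha.1 hb.1,
      Real.log_div hb.1.ne' ha.1.ne']
  intro r hr
  have hr' : r ∈ Ico (0 : ℝ) 1 := ⟨hr.1.le, hr.2⟩
  refine ⟨r * g r, fun s hs => ?_⟩
  have hs' : s ∈ Ico (0 : ℝ) 1 := ⟨hs.1.le, hs.2⟩
  have hmul : ∀ a ∈ Ioo (0 : ℝ) 1, ∀ b ∈ Ioo (0 : ℝ) 1, a ≤ b → a * g a ≤ b * g b :=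
    fun a ha b hb hab => mul_le_mul hab (hg ⟨ha.1.le, ha.2⟩ ⟨hb.1.le, hb.2⟩ hab)
      (hg0 a ⟨ha.1.le, ha.2⟩) hb.1.le
  rcases le_total r s with hrs | hrs
  · have h1 := RadialFun.IsBBT.log_sub_log hpos hmono hw hr' hs'
    have h2 : ∫ ρ in r..s, r * g r * ρ⁻¹ ≤ ∫ ρ in r..s, g ρ := by
      refine intervalIntegral.integral_mono_on hrs (hint hr hs _)
        (intervalIntegrable_of_monotoneOn_Ico hg hr' hs') fun ρ hρ => ?_
      have hρ0 : 0 < ρ := hr.1.trans_le hρ.1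
      rw [← div_eq_mul_inv, div_le_iff₀ hρ0, mul_comm (g ρ)]
      exact hmul r hr ρ ⟨hρ0, hρ.2.trans_lt hs.2⟩ hρ.1
    rw [hval hr hs] at h2
    linarith
  · have h1 := RadialFun.IsBBT.log_sub_log hpos hmono hw hs' hr'
    have h2 : ∫ ρ in s..r, g ρ ≤ ∫ ρ in s..r, r * g r * ρ⁻¹ := by
      refine intervalIntegral.integral_mono_on hrs
        (intervalIntegrable_of_monotoneOn_Ico hg hs' hr') (hint hs hr _) fun ρ hρ => ?_
      have hρ0 : 0 < ρ := hs.1.trans_le hρ.1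
      rw [← div_eq_mul_inv, le_div_iff₀ hρ0, mul_comm (g ρ)]
      exact hmul ρ ⟨hρ0, hρ.2.trans_lt hr.2⟩ r hr hρ.2
    rw [hval hs hr] at h2
    linarith

/-- The largest `c` such that `log w(r) ≥ c + n log r` on `(0, 1)`. -/
noncomputable def lineCoeff (w : RadialFun) (n : ℕ) : ℝ :=
  ⨅ s : Ioo (0 : ℝ) 1, (Real.log (w s) - n * Real.log s)

theorem log_le_log_of_monotoneOn {w : RadialFun} (hw : MonotoneOn w (Ico 0 1)) {r s : ℝ}
    (hr : 0 ≤ r) (hrs : r ≤ s) (hs : s < 1) : Real.log (w r) ≤ Real.log (w s) :=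
  Real.log_le_log (w.pos r ⟨hr, hrs.trans_lt hs⟩)
    (hw ⟨hr, hrs.trans_lt hs⟩ ⟨hr.trans hrs, hs⟩ hrs)

theorem lineCoeff_bddBelow {w : RadialFun} (hw : MonotoneOn w (Ico 0 1)) (n : ℕ) :
    BddBelow (range fun s : Ioo (0 : ℝ) 1 => Real.log (w s) - n * Real.log s) := by
  refine ⟨Real.log (w 0), ?_⟩
  rintro _ ⟨s, rfl⟩
  have h1 := log_le_log_of_monotoneOn hw le_rfl s.2.1.le s.2.2
  have h2 := mul_nonneg (Nat.cast_nonneg (α := ℝ) n) (neg_nonneg.2 (Real.log_neg s.2.1 s.2.2).le)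
  dsimp only
  linarith

instance : Nonempty (Ioo (0 : ℝ) 1) := ⟨⟨1 / 2, by norm_num, by norm_num⟩⟩

theorem lineCoeff_add_le {w : RadialFun} (hw : MonotoneOn w (Ico 0 1)) (n : ℕ) {s : ℝ}
    (hs : s ∈ Ioo (0 : ℝ) 1) : lineCoeff w n + n * Real.log s ≤ Real.log (w s) := by
  have := ciInf_le (lineCoeff_bddBelow hw n) ⟨s, hs⟩
  dsimp only at this
  unfold lineCoeff
  linarith

/-- An infimum of functions affine in `n` is concave. -/
theorem lineCoeff_concaveSeq {w : RadialFun} (hw : MonotoneOn w (Ico 0 1)) :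
    ConcaveSeq (lineCoeff w) := by
  intro p n q hpn hnq
  have hp : (p : ℝ) ≤ n := by exact_mod_cast hpn
  have hq : (n : ℝ) ≤ q := by exact_mod_cast hnq
  conv_rhs => unfold lineCoeff
  rw [Real.mul_iInf_of_nonneg (by linarith)]
  refine le_ciInf fun s => ?_
  have h1 := mul_le_mul_of_nonneg_left (lineCoeff_add_le hw p s.2) (sub_nonneg.2 hq)
  have h2 := mul_le_mul_of_nonneg_left (lineCoeff_add_le hw q s.2) (sub_nonneg.2 hp)
  linarith

/-- On `(0, R]`, finitely many of the lines below `log w` come within `-log r` of it. -/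
theorem RadialFun.HasLogSupport.exists_line {w : RadialFun} (hs : w.HasLogSupport)
    (hw : MonotoneOn w (Ico 0 1)) {R : ℝ} (hR0 : 0 < R) (hR1 : R < 1) :
    ∃ N : ℕ, ∀ r ∈ Ioc 0 R, ∃ n ≤ N,
      Real.log (w r) + Real.log r ≤ lineCoeff w n + n * Real.log r := by
  -- Evaluating a supporting line at `R'` bounds all slopes for `r ≤ R` at once.
  obtain ⟨R', hRR', hR'1⟩ := exists_between hR1
  have hR'0 : 0 < R' := hR0.trans hRR'
  have hd : 0 < Real.log R' - Real.log R := sub_pos.2 (Real.log_lt_log hR0 hRR')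
  refine ⟨⌈(Real.log (w R') - Real.log (w 0)) / (Real.log R' - Real.log R)⌉₊, fun r hr => ?_⟩
  have hr1 : r < 1 := hr.2.trans_lt hR1
  obtain ⟨m, hm⟩ := hs r ⟨hr.1, hr1⟩
  have hm0 : 0 ≤ m := by
    have h1 := hm (r / 2) ⟨by linarith [hr.1], by linarith [hr.1]⟩
    have h2 := log_le_log_of_monotoneOn hw (r := r / 2) (s := r) (by linarith [hr.1])
      (by linarith [hr.1]) hr1
    have h3 : Real.log (r / 2) < Real.log r := Real.log_lt_log (by linarith [hr.1])
      (by linarith [hr.1])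
    by_contra! hneg
    nlinarith
  refine ⟨⌈m⌉₊, Nat.ceil_mono ?_, ?_⟩
  · rw [le_div_iff₀ hd]
    have h1 := hm R' ⟨hR'0, hR'1⟩
    have h2 := log_le_log_of_monotoneOn hw le_rfl hr.1.le hr1
    have h3 : Real.log r ≤ Real.log R := Real.log_le_log hr.1 hr.2
    nlinarith
  -- Since `log s < 0`, the line with the rounded slope and the same value at `log s = 0` stays
  -- below `log w`, and it loses at most `-log r` at `r`.
  · have hceil : m ≤ (⌈m⌉₊ : ℝ) := Nat.le_ceil m
    have hceil' : (⌈m⌉₊ : ℝ) < m + 1 := Nat.ceil_lt_add_one hm0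
    have h1 : Real.log (w r) - m * Real.log r ≤ lineCoeff w ⌈m⌉₊ := by
      refine le_ciInf fun s => ?_
      have h2 := hm s s.2
      have h3 := Real.log_neg s.2.1 s.2.2
      nlinarith
    have h4 := Real.log_neg hr.1 hr1
    nlinarith

/-- For each `R < 1` there is a polynomial with non-negative coefficients that is dominated by a
fixed multiple of `w` and dominates a fixed multiple of `r w(r)` on `(0, R]`. -/
theorem RadialFun.HasLogSupport.exists_polynomial {w : RadialFun} (hs : w.HasLogSupport)
    (hw : MonotoneOn w (Ico 0 1)) {R : ℝ} (hR0 : 0 < R) (hR1 : R < 1) :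
    ∃ (S : Finset ℕ) (a : ℕ → ℝ), (∀ n, 0 ≤ a n) ∧
      (∀ r ∈ Ioo (0 : ℝ) 1, ∑ n ∈ S, a n * r ^ n ≤ 8 * w r) ∧
      ∀ r ∈ Ioc 0 R, r * w r ≤ Real.exp 1 * ∑ n ∈ S, a n * r ^ n := by
  obtain ⟨N, hN⟩ := hs.exists_line hw hR0 hR1
  obtain ⟨S, hcov, hsum⟩ := (lineCoeff_concaveSeq hw).exists_sparse N
  have hterm : ∀ r : ℝ, 0 < r → ∀ n : ℕ,
      Real.exp (lineCoeff w n) * r ^ n = Real.exp (lineCoeff w n + n * Real.log r) := by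
    intro r hr n
    rw [Real.exp_add, Real.exp_nat_mul, Real.exp_log hr]
  refine ⟨S, fun n => Real.exp (lineCoeff w n), fun n => (Real.exp_pos _).le, ?_, ?_⟩
  · intro r hr
    obtain ⟨n, hn⟩ := hsum (Real.log r)
    simp only [hterm r hr.1]
    refine hn.trans (mul_le_mul_of_nonneg_left ?_ (by norm_num))
    rw [← Real.exp_log (w.pos r ⟨hr.1.le, hr.2⟩)]
    exact Real.exp_le_exp.2 (lineCoeff_add_le hw n hr)
  · intro r hr
    have hwr := w.pos r ⟨hr.1.le, hr.2.trans_lt hR1⟩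
    obtain ⟨n, hnN, hn⟩ := hN r hr
    obtain ⟨s, hsS, h⟩ := hcov (Real.log r) n hnN
    simp only [hterm r hr.1]
    calc r * w r = Real.exp (Real.log (w r) + Real.log r) := by
          rw [Real.exp_add, Real.exp_log hwr, Real.exp_log hr.1, mul_comm]
      _ ≤ Real.exp (1 + (lineCoeff w s + s * Real.log r)) :=
          Real.exp_le_exp.2 (by linarith)
      _ = Real.exp 1 * Real.exp (lineCoeff w s + s * Real.log r) := Real.exp_add _ _
      _ ≤ _ := mul_le_mul_of_nonneg_left
          (Finset.single_le_sum (f := fun t : ℕ => Real.exp (lineCoeff w t + t * Real.log r))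
            (fun t _ => (Real.exp_pos _).le) hsS) (Real.exp_pos 1).le

/-! ### The integration operator -/

theorem RadialFun.integral_nonneg (w : RadialFun) {a b : ℝ} (ha : 0 ≤ a) (hab : a ≤ b)
    (hb : b < 1) : 0 ≤ ∫ t in a..b, w t :=
  intervalIntegral.integral_nonneg hab fun t ht => (w.pos t ⟨ha.trans ht.1, ht.2.trans_lt hb⟩).le

theorem smul_mem_Disc {z : ℂ} (hz : z ∈ Disc) {t : ℝ} (ht : t ∈ Icc (0 : ℝ) 1) :
    (t : ℂ) * z ∈ Disc := by
  rw [mem_ball_zero_iff] at hz ⊢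
  rw [norm_mul, Complex.norm_real, Real.norm_of_nonneg ht.1]
  nlinarith [ht.1, ht.2, norm_nonneg z]

theorem IsHol.continuousOn_segment {f : Disc → ℂ} (hf : IsHol f) (z : Disc) :
    ContinuousOn (fun t : ℝ => ext f ((t : ℂ) * z)) (uIcc 0 1) := by
  refine hf.continuousOn.comp (by fun_prop) fun t ht => ?_
  rw [uIcc_of_le zero_le_one] at ht
  exact smul_mem_Disc z.2 ht

/-- On the disc `f` has a primitive `F`, and the segment integral equals `F z - F 0`. -/
theorem IsHol.integration {f : Disc → ℂ} (hf : IsHol f) : IsHol (integration f) := by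
  obtain ⟨F, hF⟩ := DifferentiableOn.isExactOn_ball hf
  refine isHol_of_eqOn (F := fun z => F z - F 0)
    (fun z hz => ((hF z hz).differentiableAt.sub_const _).differentiableWithinAt) fun z => ?_
  have hd : ∀ t ∈ uIcc (0 : ℝ) 1,
      HasDerivAt (fun t : ℝ => F ((t : ℂ) * z)) (ext f ((t : ℂ) * z) * z) t := by
    intro t ht
    rw [uIcc_of_le zero_le_one] at ht
    have h1 := hF _ (smul_mem_Disc z.2 ht)
    have h2 : HasDerivAt (fun t : ℝ => (t : ℂ) * (z : ℂ)) (z : ℂ) t := by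
      simpa using (Complex.ofRealCLM.hasDerivAt (x := t)).mul_const (z : ℂ)
    exact h1.comp t h2
  have := intervalIntegral.integral_eq_sub_of_hasDerivAt hd
    ((hf.continuousOn_segment z).mul continuousOn_const).intervalIntegrable
  rw [intervalIntegral.integral_mul_const] at this
  simp only [Complex.ofReal_one, one_mul, Complex.ofReal_zero, zero_mul] at this
  rw [← this, mul_comm]
  rfl

theorem norm_integration_le {w : RadialFun} (hw : MonotoneOn w (Ico 0 1)) (f : HSpace w)
    (z : Disc) : ‖integration f z‖ ≤ ‖f‖ * ∫ t in (0 : ℝ)..‖(z : ℂ)‖, w t := by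
  have hz : ‖(z : ℂ)‖ < 1 := mem_ball_zero_iff.1 z.2
  have hmem : ∀ t ∈ Icc (0 : ℝ) 1, ‖(z : ℂ)‖ * t ∈ Ico (0 : ℝ) 1 := fun t ht =>
    ⟨mul_nonneg (norm_nonneg _) ht.1, by nlinarith [ht.1, ht.2, norm_nonneg (z : ℂ)]⟩
  have hmono : MonotoneOn (fun t => w (‖(z : ℂ)‖ * t)) (uIcc 0 1) := by
    rw [uIcc_of_le zero_le_one]
    exact fun a ha b hb hab => hw (hmem a ha) (hmem b hb)
      (mul_le_mul_of_nonneg_left hab (norm_nonneg _))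
  have h1 : ‖∫ t in (0 : ℝ)..1, ext f ((t : ℂ) * z)‖
      ≤ ∫ t in (0 : ℝ)..1, ‖f‖ * w (‖(z : ℂ)‖ * t) := by
    refine intervalIntegral.norm_integral_le_of_norm_le zero_le_one
      (Eventually.of_forall fun t ht => ?_) (hmono.intervalIntegrable.const_mul _)
    have ht' : t ∈ Icc (0 : ℝ) 1 := ⟨ht.1.le, ht.2⟩
    have h := f.le_norm ⟨_, smul_mem_Disc z.2 ht'⟩
    have hn : ‖(t : ℂ) * (z : ℂ)‖ = ‖(z : ℂ)‖ * t := by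
      rw [norm_mul, Complex.norm_real, Real.norm_of_nonneg ht'.1, mul_comm]
    rw [div_le_iff₀ (w.pos_norm _)] at h
    rw [← hn]
    exact (congrArg norm (ext_apply f ⟨_, smul_mem_Disc z.2 ht'⟩)).trans_le h
  calc ‖integration f z‖ = ‖(z : ℂ)‖ * ‖∫ t in (0 : ℝ)..1, ext f ((t : ℂ) * z)‖ := norm_mul _ _
    _ ≤ ‖(z : ℂ)‖ * ∫ t in (0 : ℝ)..1, ‖f‖ * w (‖(z : ℂ)‖ * t) :=
        mul_le_mul_of_nonneg_left h1 (norm_nonneg _)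
    _ = ‖f‖ * (‖(z : ℂ)‖ * ∫ t in (0 : ℝ)..1, w (‖(z : ℂ)‖ * t)) := by
        rw [intervalIntegral.integral_const_mul]; ring
    _ = _ := by rw [intervalIntegral.mul_integral_comp_mul_left, mul_zero, mul_one]

theorem integrationBounded_of_integral_le {w v : RadialFun} (hw : MonotoneOn w (Ico 0 1)) {K : ℝ}
    (hK : ∀ r ∈ Ico (0 : ℝ) 1, ∫ t in (0 : ℝ)..r, w t ≤ K * v r) : IntegrationBounded w v := by
  have hbound : ∀ (f : HSpace w) (z : Disc),
      ‖integration f z‖ / v ‖(z : ℂ)‖ ≤ K * ‖f‖ := by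
    intro f z
    have hz : ‖(z : ℂ)‖ ∈ Ico (0 : ℝ) 1 := ⟨norm_nonneg _, mem_ball_zero_iff.1 z.2⟩
    rw [div_le_iff₀ (v.pos_norm z)]
    refine (norm_integration_le hw f z).trans ?_
    refine (mul_le_mul_of_nonneg_left (hK _ hz) (norm_nonneg f)).trans_eq ?_
    ring
  let T : HSpace w →ₗ[ℂ] HSpace v :=
    { toFun := fun f => ⟨integration f, f.2.1.integration, K * ‖f‖, by
        rintro _ ⟨z, rfl⟩; exact hbound f z⟩
      map_add' := fun f g => by
        refine Subtype.ext (funext fun z => ?_)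
        have hf := (f.2.1.continuousOn_segment z).intervalIntegrable (μ := MeasureTheory.volume)
        have hg := (g.2.1.continuousOn_segment z).intervalIntegrable (μ := MeasureTheory.volume)
        change (z : ℂ) * (∫ t in (0 : ℝ)..1, ext (f + g) ((t : ℂ) * z)) =
          (z : ℂ) * (∫ t in (0 : ℝ)..1, ext f ((t : ℂ) * z)) +
            (z : ℂ) * ∫ t in (0 : ℝ)..1, ext g ((t : ℂ) * z)
        rw [← mul_add, ← intervalIntegral.integral_add hf hg]
        refine congrArg ((z : ℂ) * ·) (intervalIntegral.integral_congr fun t ht => ?_)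
        rw [uIcc_of_le zero_le_one] at ht
        have e := fun h : Disc → ℂ => ext_apply h ⟨_, smul_mem_Disc z.2 ht⟩
        exact (e _).trans (congrArg₂ (· + ·) (e f).symm (e g).symm)
      map_smul' := fun c f => by
        refine Subtype.ext (funext fun z => ?_)
        change (z : ℂ) * (∫ t in (0 : ℝ)..1, ext (c • f) ((t : ℂ) * z)) =
          c * ((z : ℂ) * ∫ t in (0 : ℝ)..1, ext f ((t : ℂ) * z))
        rw [mul_left_comm, ← intervalIntegral.integral_const_mul c]
        refine congrArg ((z : ℂ) * ·) (intervalIntegral.integral_congr fun t ht => ?_)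
        rw [uIcc_of_le zero_le_one] at ht
        have e := fun h : Disc → ℂ => ext_apply h ⟨_, smul_mem_Disc z.2 ht⟩
        exact (e _).trans (congrArg (c * ·) (e f).symm) }
  exact ⟨T.mkContinuous K fun f => ciSup_le (hbound f), fun f => rfl⟩

/-- A polynomial as a function on the disc. -/
noncomputable def polyFun (S : Finset ℕ) (a : ℕ → ℝ) : Disc → ℂ :=
  fun z => ∑ n ∈ S, (a n : ℂ) * (z : ℂ) ^ n

theorem norm_polyFun_le {S : Finset ℕ} {a : ℕ → ℝ} (ha : ∀ n, 0 ≤ a n) (z : Disc) {r : ℝ}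
    (hr : ‖(z : ℂ)‖ ≤ r) : ‖polyFun S a z‖ ≤ ∑ n ∈ S, a n * r ^ n := by
  refine (norm_sum_le _ _).trans (Finset.sum_le_sum fun n _ => ?_)
  rw [norm_mul, norm_pow, Complex.norm_real, Real.norm_of_nonneg (ha n)]
  exact mul_le_mul_of_nonneg_left (pow_le_pow_left₀ (norm_nonneg _) hr n) (ha n)

theorem norm_polyFun_div_le {w : RadialFun} (hw : MonotoneOn w (Ico 0 1)) {S : Finset ℕ}
    {a : ℕ → ℝ} (ha : ∀ n, 0 ≤ a n)
    (hle : ∀ r ∈ Ioo (0 : ℝ) 1, ∑ n ∈ S, a n * r ^ n ≤ 8 * w r) (z : Disc) :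
    ‖polyFun S a z‖ / w ‖(z : ℂ)‖ ≤ 8 * w (1 / 2) / w 0 := by
  have h0 := w.pos 0 zero_mem_Ico_zero_one
  have hh : (1 / 2 : ℝ) ∈ Ico (0 : ℝ) 1 := by norm_num
  have h0h : w 0 ≤ w (1 / 2) := hw zero_mem_Ico_zero_one hh hh.1
  rcases (norm_nonneg (z : ℂ)).eq_or_lt with hz | hz
  -- The bound `hle` says nothing at `0`, and `w` may jump there; the sum at `1 / 2` is used
  -- instead.
  · rw [← hz]
    refine div_le_div_of_nonneg_right ?_ h0.le
    exact (norm_polyFun_le ha z (by rw [← hz]; norm_num)).trans (hle _ (by norm_num))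
  · have h1 := (norm_polyFun_le (S := S) ha z le_rfl).trans
      (hle _ ⟨hz, mem_ball_zero_iff.1 z.2⟩)
    calc ‖polyFun S a z‖ / w ‖(z : ℂ)‖ ≤ 8 := (div_le_iff₀ (w.pos_norm z)).2 h1
      _ ≤ 8 * w (1 / 2) / w 0 := by rw [le_div_iff₀ h0]; linarith

theorem isHol_polyFun (S : Finset ℕ) (a : ℕ → ℝ) : IsHol (polyFun S a) :=
  isHol_of_eqOn (F := fun z => ∑ n ∈ S, (a n : ℂ) * z ^ n) (by fun_prop) fun _ => rfl

theorem integration_polyFun (S : Finset ℕ) (a : ℕ → ℝ) {R : ℝ} (hR : (R : ℂ) ∈ Disc) :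
    integration (polyFun S a) ⟨R, hR⟩ =
      ((∫ t in (0 : ℝ)..R, ∑ n ∈ S, a n * t ^ n : ℝ) : ℂ) := by
  have h1 : ∫ t in (0 : ℝ)..1, ext (polyFun S a) ((t : ℂ) * (R : ℂ)) =
      ∫ t in (0 : ℝ)..1, ((∑ n ∈ S, a n * (R * t) ^ n : ℝ) : ℂ) := by
    refine intervalIntegral.integral_congr fun t ht => ?_
    rw [uIcc_of_le zero_le_one] at ht
    refine (ext_apply _ ⟨_, smul_mem_Disc hR ht⟩).trans ?_
    simp [polyFun, mul_comm]
  change (R : ℂ) * (∫ t in (0 : ℝ)..1, ext (polyFun S a) ((t : ℂ) * (R : ℂ))) = _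
  rw [h1, intervalIntegral.integral_ofReal, ← Complex.ofReal_mul,
    intervalIntegral.mul_integral_comp_mul_left (f := fun t => ∑ n ∈ S, a n * t ^ n),
    mul_zero, mul_one]

theorem IntegrationBounded.exists_integral_le {w v : RadialFun} (h : IntegrationBounded w v)
    (hs : w.HasLogSupport) (hw : MonotoneOn w (Ico 0 1)) (hv : MonotoneOn v (Ico 0 1)) :
    ∃ K : ℝ, ∀ R ∈ Ico (1 / 2 : ℝ) 1, ∫ t in (0 : ℝ)..R, w t ≤ K * v R := by
  obtain ⟨T, hT⟩ := h
  set B : ℝ := 8 * w (1 / 2) / w 0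
  have hh : (1 / 2 : ℝ) ∈ Ico (0 : ℝ) 1 := by norm_num
  -- The first term covers `[0, 1/2]` through `v 0 ≤ v R`; on `[1/2, R]` the factor `t` in `t w(t) ≤
  -- e P(t)` costs at most `2`.
  refine ⟨(∫ t in (0 : ℝ)..(1 / 2), w t) / v 0 + 2 * Real.exp 1 * (‖T‖ * B), fun R hR => ?_⟩
  have hR0 : 0 < R := by linarith [hR.1]
  have hRI : R ∈ Ico (0 : ℝ) 1 := ⟨hR0.le, hR.2⟩
  obtain ⟨S, a, ha, hle, hge⟩ := hs.exists_polynomial hw hR0 hR.2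
  let f : HSpace w := ⟨polyFun S a, isHol_polyFun S a, B, by
    rintro _ ⟨z, rfl⟩; exact norm_polyFun_div_le hw ha hle z⟩
  have hf : ‖f‖ ≤ B := ciSup_le (norm_polyFun_div_le hw ha hle)
  have hRn : ‖(R : ℂ)‖ = R := by rw [Complex.norm_real, Real.norm_of_nonneg hR0.le]
  have hRD : (R : ℂ) ∈ Disc := by rw [mem_ball_zero_iff, hRn]; exact hR.2
  have hvR := v.pos R hRI
  set P : ℝ → ℝ := fun t => ∑ n ∈ S, a n * t ^ n with hP
  have hPc : Continuous P := by fun_prop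
  have hP0 : ∀ t, 0 ≤ t → 0 ≤ P t := fun t ht =>
    Finset.sum_nonneg fun n _ => mul_nonneg (ha n) (pow_nonneg ht n)
  have hIP : ∫ t in (0 : ℝ)..R, P t ≤ ‖T‖ * B * v R := by
    have h1 := (T f).le_norm ⟨R, hRD⟩
    have h2 : (T f) ⟨R, hRD⟩ = ((∫ t in (0 : ℝ)..R, P t : ℝ) : ℂ) :=
      (congrFun (hT f) ⟨R, hRD⟩).trans (integration_polyFun S a hRD)
    rw [h2, Complex.norm_real] at h1
    simp only [hRn] at h1
    rw [div_le_iff₀ hvR] at h1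
    refine (le_abs_self _).trans (h1.trans (mul_le_mul_of_nonneg_right ?_ hvR.le))
    exact (T.le_opNorm f).trans (mul_le_mul_of_nonneg_left hf (norm_nonneg _))
  have hsplit : ∫ t in (1 / 2 : ℝ)..R, w t ≤ 2 * Real.exp 1 * ∫ t in (0 : ℝ)..R, P t := by
    have h1 : ∫ t in (1 / 2 : ℝ)..R, w t ≤ ∫ t in (1 / 2 : ℝ)..R, 2 * Real.exp 1 * P t := by
      refine intervalIntegral.integral_mono_on hR.1
        (intervalIntegrable_of_monotoneOn_Ico hw hh hRI)
        ((continuous_const.mul hPc).intervalIntegrable _ _) fun t ht => ?_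
      have ht0 : 0 < t := by linarith [ht.1]
      have h2 := hge t ⟨ht0, ht.2⟩
      have h3 := w.pos t ⟨ht0.le, ht.2.trans_lt hR.2⟩
      change t * w t ≤ Real.exp 1 * P t at h2
      nlinarith [ht.1]
    rw [intervalIntegral.integral_const_mul] at h1
    refine h1.trans (mul_le_mul_of_nonneg_left ?_ (by positivity))
    rw [← intervalIntegral.integral_add_adjacent_intervals (hPc.intervalIntegrable 0 (1 / 2))
      (hPc.intervalIntegrable (1 / 2) R)]
    linarith [intervalIntegral.integral_nonneg (μ := MeasureTheory.volume) hh.1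
      fun t (ht : t ∈ Icc (0 : ℝ) (1 / 2)) => hP0 t ht.1]
  have hstart : ∫ t in (0 : ℝ)..(1 / 2), w t ≤ (∫ t in (0 : ℝ)..(1 / 2), w t) / v 0 * v R := by
    have hv0 := v.pos 0 zero_mem_Ico_zero_one
    rw [div_mul_eq_mul_div, le_div_iff₀ hv0]
    exact mul_le_mul_of_nonneg_left (hv zero_mem_Ico_zero_one hRI hR0.le)
      (w.integral_nonneg le_rfl hh.1 hh.2)
  rw [← intervalIntegral.integral_add_adjacent_intervals
    (intervalIntegrable_of_monotoneOn_Ico hw zero_mem_Ico_zero_one hh)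
    (intervalIntegrable_of_monotoneOn_Ico hw hh hRI)]
  have := mul_le_mul_of_nonneg_left hIP (by positivity : (0 : ℝ) ≤ 2 * Real.exp 1)
  linarith

/-! ### The limsup condition as an integral inequality -/

theorem exists_integral_le_of_limsup_lt_top {w v : RadialFun} (hw : MonotoneOn w (Ico 0 1))
    (hv : MonotoneOn v (Ico 0 1))
    (h : limsup (fun r : ℝ => ((1 / v r * ∫ t in (0 : ℝ)..r, w t : ℝ) : EReal)) (𝓝[<] 1) < ⊤) :
    ∃ K : ℝ, ∀ r ∈ Ico (0 : ℝ) 1, ∫ t in (0 : ℝ)..r, w t ≤ K * v r := by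
  obtain ⟨K, hK, -⟩ := EReal.lt_iff_exists_real_btwn.1 h
  have hev := eventually_lt_of_limsup_lt hK
  obtain ⟨l, hl, hlK⟩ := (mem_nhdsLT_iff_exists_Ioo_subset' (zero_lt_one (α := ℝ))).1 hev
  set r₀ := max l 0
  have hr₀ : r₀ ∈ Ico (0 : ℝ) 1 := ⟨le_max_right _ _, max_lt hl zero_lt_one⟩
  have hv0 := v.pos 0 zero_mem_Ico_zero_one
  -- The limsup gives `K` only beyond `r₀`; up to `r₀` the integral is at most its value there and
  -- `v ≥ v 0`.
  refine ⟨max K ((∫ t in (0 : ℝ)..r₀, w t) / v 0), fun r hr => ?_⟩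
  have hvr := v.pos r hr
  rcases le_or_gt r r₀ with hle | hlt
  · have h1 : ∫ t in (0 : ℝ)..r, w t ≤ ∫ t in (0 : ℝ)..r₀, w t := by
      rw [← intervalIntegral.integral_add_adjacent_intervals
        (intervalIntegrable_of_monotoneOn_Ico hw zero_mem_Ico_zero_one hr)
        (intervalIntegrable_of_monotoneOn_Ico hw hr hr₀)]
      linarith [w.integral_nonneg hr.1 hle hr₀.2]
    have h2 : ∫ t in (0 : ℝ)..r₀, w t ≤ (∫ t in (0 : ℝ)..r₀, w t) / v 0 * v r := by
      rw [div_mul_eq_mul_div, le_div_iff₀ hv0]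
      exact mul_le_mul_of_nonneg_left (hv zero_mem_Ico_zero_one hr hr.1)
        (w.integral_nonneg le_rfl hr₀.1 hr₀.2)
    exact (h1.trans h2).trans (mul_le_mul_of_nonneg_right (le_max_right _ _) hvr.le)
  · have h1 : ((1 / v r * ∫ t in (0 : ℝ)..r, w t : ℝ) : EReal) < K :=
      hlK ⟨(le_max_left _ _).trans_lt hlt, hr.2⟩
    rw [EReal.coe_lt_coe_iff, one_div_mul_eq_div, div_lt_iff₀ hvr] at h1
    exact h1.le.trans (mul_le_mul_of_nonneg_right (le_max_left _ _) hvr.le)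

theorem limsup_lt_top_of_integral_le {w v : RadialFun} {K : ℝ}
    (hK : ∀ r ∈ Ico (1 / 2 : ℝ) 1, ∫ t in (0 : ℝ)..r, w t ≤ K * v r) :
    limsup (fun r : ℝ => ((1 / v r * ∫ t in (0 : ℝ)..r, w t : ℝ) : EReal)) (𝓝[<] 1) < ⊤ := by
  refine lt_of_le_of_lt (limsup_le_of_le (a := (K : EReal)) (by isBoundedDefault) ?_)
    (EReal.coe_lt_top K)
  filter_upwards [Ioo_mem_nhdsLT (show (1 / 2 : ℝ) < 1 by norm_num)] with r hr
  rw [EReal.coe_le_coe_iff, one_div_mul_eq_div,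
    div_le_iff₀ (v.pos r ⟨by linarith [hr.1], hr.2⟩)]
  exact hK r ⟨hr.1.le, hr.2⟩

end DiscWeighted

open DiscWeighted in
theorem mainTheorem8 (w v : RadialFun) (hw : w.IsBBT ∨ w.IsHWeight) (hv : v.IsRadialWeight) :
    IntegrationBounded w v ↔
      Filter.limsup (fun r : ℝ => ((1 / v r * ∫ t in (0 : ℝ)..r, w t : ℝ) : EReal))
        (nhdsWithin 1 (Set.Iio 1)) < ⊤ := by
  obtain ⟨hmono, hsupp⟩ : MonotoneOn w (Set.Ico 0 1) ∧ w.HasLogSupport := by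
    rcases hw with h | h
    · exact ⟨h.monotoneOn, h.hasLogSupport⟩
    · exact ⟨h.monotoneOn, h.logConvex.hasLogSupport⟩
  constructor
  · intro h
    obtain ⟨K, hK⟩ := h.exists_integral_le hsupp hmono hv.monotoneOn
    exact limsup_lt_top_of_integral_le hK
  · intro h
    obtain ⟨K, hK⟩ := exists_integral_le_of_limsup_lt_top hmono hv.monotoneOn h
    exact integrationBounded_of_integral_le hmono hK
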